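/- Let $F \subseteq E$ be a Galois extension of finite degree, and let $\mathfrak{g}$ and $\mathfrak{h}$ be finite-dimensional Lie algebras over $E$. Write $\mathfrak{g}_F$ for the Lie algebra over $F$ obtained from $\mathfrak{g}$ by restricting the scalar multiplication to $F$, and similarly $\mathfrak{h}_F$. A Lie algebra over $E$ is said to be defined over $F$ if it is isomorphic, over $E$, to $\mathfrak{l} \otimes_F E$ for some Lie algebra $\mathfrak{l}$ over $F$; it is called indecomposable if it is not the direct sum of two ideals that are both proper (different from the whole algebra). Suppose that $\mathfrak{g}$ is defined over $F$ and that $\mathfrak{g}_F \cong \mathfrak{h}_F$ as Lie algebras over $F$. If either 1. $\mathfrak{h}$ is defined over $F$, or 2. $\mathfrak{g}$ is indecomposable, then $\mathfrak{g} \cong \mathfrak{h}$ as Lie algebras over $E$. -/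

import Mathlib

open scoped TensorProduct

/-- A Lie algebra `h` over `E` is *defined over* `F` if it is isomorphic, as a Lie algebra over `E`,
to the extension of scalars `E ⊗[F] L` of some Lie algebra `L` over `F`. Letting `L` range over the
universe of `h` loses nothing, because `L` embeds into `E ⊗[F] L`. -/
def LieIsDefinedOver.{u₁, u₂, v} (F : Type u₁) (E : Type u₂) [Field F] [Field E] [Algebra F E]
    (h : Type v) [LieRing h] [LieAlgebra E h] : Prop :=
  ∃ (L : Type v) (_ : LieRing L) (_ : LieAlgebra F L), Nonempty (h ≃ₗ⁅E⁆ E ⊗[F] L)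

/-- A Lie algebra is *decomposable* if it is the direct sum of two proper ideals. -/
def LieIsDecomposable (E g : Type*) [Field E] [LieRing g] [LieAlgebra E g] : Prop :=
  ∃ I J : LieIdeal E g, I ≠ ⊤ ∧ J ≠ ⊤ ∧ IsCompl I J

/-- A Lie algebra is *indecomposable* if it is not decomposable. -/
def LieIsIndecomposable (E g : Type*) [Field E] [LieRing g] [LieAlgebra E g] : Prop :=
  ¬ LieIsDecomposable E g

/-! Extending `g`, seen over `F`, back to `E` gives the product of the conjugates of `g` under the
Galois group, by Dedekind independence and a dimension count. If `g` is defined over `F`, every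
conjugate is isomorphic to `g`, so `E ⊗[F] g` is a power of `g`. An `F`-isomorphism of `g` with `h`
thus identifies a power of `g` with the product of the conjugates of `h`. If `h` is also defined
over `F`, two equal finite powers are isomorphic, and Krull-Schmidt arguments extract the root. If
`g` is indecomposable, it is a factor of some conjugate of `h`, equal to it by dimension; a
semilinear automorphism of `g` removes the twist. The Krull-Schmidt part rests on Fitting's lemma:
on an indecomposable algebra, an endomorphism commuting with every `ad y` is invertible or
nilpotent. The maps from a factor through the other factors and back are of this kind and sum to the
identity, so one of them is invertible. -/

/-! ### Fitting's lemma and local endomorphism rings. -/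

section Fitting

variable {E I : Type*} [Field E] [LieRing I] [LieAlgebra E I] [FiniteDimensional E I]

/-- Fitting's lemma for the adjoint module of an indecomposable Lie algebra. -/
theorem LieIsIndecomposable.isUnit_or_isNilpotent (hI : LieIsIndecomposable E I)
    (a : Module.End E I) (ha : ∀ y x : I, a ⁅y, x⁆ = ⁅y, a x⁆) : IsUnit a ∨ IsNilpotent a := by
  -- Besides the Fitting splitting, `n ≥ 1` is needed to pass from `a ^ n` invertible to `a`
  -- invertible.
  obtain ⟨n, hn, hn1⟩ := ((LinearMap.eventually_isCompl_ker_pow_range_pow a).and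
    (Filter.eventually_ge_atTop 1)).exists
  have hpow : ∀ (k : ℕ) (y x : I), (a ^ k) ⁅y, x⁆ = ⁅y, (a ^ k) x⁆ := by
    intro k
    induction k with
    | zero => simp
    | succ k ih => intro y x; rw [pow_succ', Module.End.mul_apply, ih, ha]; rfl
  let K : LieIdeal E I :=
    { LinearMap.ker (a ^ n) with
      lie_mem := by
        intro x m hm
        change (a ^ n) ⁅x, m⁆ = 0
        rw [hpow, show (a ^ n) m = 0 from hm, lie_zero] }
  let R : LieIdeal E I :=
    { LinearMap.range (a ^ n) with
      lie_mem := by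
        rintro x m ⟨z, rfl⟩
        exact ⟨⁅x, z⁆, hpow n x z⟩ }
  have hKR : IsCompl K R := by
    rw [← LieSubmodule.isCompl_toSubmodule]
    exact hn
  by_cases hK : K = ⊤
  · refine Or.inr ⟨n, LinearMap.ext fun x => ?_⟩
    have : x ∈ K := hK ▸ LieSubmodule.mem_top x
    exact this
  · by_cases hR : R = ⊤
    · refine Or.inl ?_
      have hs : Function.Surjective (a ^ n) := fun x => by
        have : x ∈ R := hR ▸ LieSubmodule.mem_top x
        exact this
      have hu : IsUnit (a ^ n) := by
        rw [LinearMap.isUnit_iff_range_eq_top]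
        exact LinearMap.range_eq_top.2 hs
      exact (isUnit_pow_iff (by omega)).1 hu
    · exact absurd ⟨K, R, hK, hR, hKR⟩ hI

/-- The ring of endomorphisms of the adjoint module of an indecomposable Lie algebra is local. -/
theorem LieIsIndecomposable.exists_isUnit_of_isUnit_sum [Nontrivial I]
    (hI : LieIsIndecomposable E I) {ι : Type*} (s : Finset ι) (f : ι → Module.End E I)
    (hf : ∀ i, ∀ y x : I, f i ⁅y, x⁆ = ⁅y, f i x⁆) (hs : IsUnit (∑ i ∈ s, f i)) :
    ∃ i ∈ s, IsUnit (f i) := by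
  classical
  induction s using Finset.induction_on with
  | empty => simp at hs
  | insert i t hit ih =>
    rw [Finset.sum_insert hit] at hs
    obtain ⟨c, hc⟩ := hs
    have hcc : ∀ y x : I, (c : Module.End E I) ⁅y, x⁆ = ⁅y, (c : Module.End E I) x⁆ := by
      intro y x
      rw [hc]
      simp only [LinearMap.add_apply, LinearMap.sum_apply, hf, lie_add, lie_sum]
    have hci : ∀ x, (c : Module.End E I) ((c⁻¹ : (Module.End E I)ˣ).val x) = x := fun x => by
      rw [← Module.End.mul_apply, Units.mul_inv]; rfl
    have hic : ∀ x, (c⁻¹ : (Module.End E I)ˣ).val ((c : Module.End E I) x) = x := fun x => by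
      rw [← Module.End.mul_apply, Units.inv_mul]; rfl
    have hcc' : ∀ y x : I, (c⁻¹ : (Module.End E I)ˣ).val ⁅y, x⁆ =
        ⁅y, (c⁻¹ : (Module.End E I)ˣ).val x⁆ := by
      intro y x
      conv_lhs => rw [← hci x, ← hcc, hic]
    -- Dividing by `c` makes the sum 1: if the term of `i` is nilpotent, 1 minus it is a unit, and
    -- that is the rest of the sum divided by `c`.
    rcases hI.isUnit_or_isNilpotent ((c⁻¹ : (Module.End E I)ˣ).val * f i) (fun y x => by
      simp only [Module.End.mul_apply, hf, hcc']) with h | h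
    · exact ⟨i, Finset.mem_insert_self _ _, (Units.isUnit_units_mul _ _).1 h⟩
    · have h1 := h.isUnit_one_sub
      have h2 : (1 : Module.End E I) - (c⁻¹ : (Module.End E I)ˣ).val * f i =
          (c⁻¹ : (Module.End E I)ˣ).val * ∑ j ∈ t, f j := by
        rw [← Units.inv_mul c, ← mul_sub, hc, add_sub_cancel_left]
      rw [h2] at h1
      obtain ⟨j, hj, hj'⟩ := ih ((Units.isUnit_units_mul _ _).1 h1)
      exact ⟨j, Finset.mem_insert_of_mem hj, hj'⟩

end Fitting

/-! ### Lie structure on products of families. -/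

section Pi

variable {ι : Type*} {X : ι → Type*} [∀ i, LieRing (X i)]

instance Pi.instLieRing : LieRing (∀ i, X i) where
  bracket x y i := ⁅x i, y i⁆
  add_lie x y z := funext fun i => add_lie (x i) (y i) (z i)
  lie_add x y z := funext fun i => lie_add (x i) (y i) (z i)
  lie_self x := funext fun i => lie_self (x i)
  leibniz_lie x y z := funext fun i => leibniz_lie (x i) (y i) (z i)

instance Pi.instLieAlgebra {E : Type*} [CommRing E] [∀ i, LieAlgebra E (X i)] :
    LieAlgebra E (∀ i, X i) where
  lie_smul t x y := funext fun i => lie_smul t (x i) (y i)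

end Pi

/-! ### Direct factors and the exchange property. -/

section Exchange

variable {E I K G J : Type*} [Field E] [LieRing I] [LieAlgebra E I] [LieRing K] [LieAlgebra E K]
  [LieRing G] [LieAlgebra E G] [LieRing J] [LieAlgebra E J]

/-- A realization of the Lie algebra `J` as a direct factor of the Lie algebra `G`. -/
structure LieFactor (E G J : Type*) [Field E] [LieRing G] [LieAlgebra E G] [LieRing J]
    [LieAlgebra E J] where
  /-- The projection. -/
  proj : G →ₗ⁅E⁆ J
  /-- The inclusion. -/
  incl : J →ₗ[E] G
  proj_incl : ∀ j, proj (incl j) = j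
  incl_lie : ∀ x j, incl ⁅proj x, j⁆ = ⁅x, incl j⁆

namespace LieFactor

/-- The first factor of a product. -/
def fst : LieFactor E (J × K) J where
  proj := LieHom.fst E J K
  incl := LinearMap.inl E J K
  proj_incl _ := rfl
  incl_lie _ _ := by simp

/-- A factor of a product of a family. -/
def pi {ι : Type*} [DecidableEq ι] (X : ι → Type*) [∀ i, LieRing (X i)]
    [∀ i, LieAlgebra E (X i)] (i : ι) : LieFactor E (∀ i, X i) (X i) where
  proj := { LinearMap.proj i with map_lie' := by intros; rfl }
  incl := LinearMap.single E X i
  proj_incl j := by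
    change Pi.single (M := X) i j i = j
    simp
  incl_lie x j := by
    funext k
    change Pi.single (M := X) i ⁅x i, j⁆ k = ⁅x k, Pi.single (M := X) i j k⁆
    by_cases h : k = i
    · subst h; simp
    · simp [h]

/-- Transport of a factor along an isomorphism. -/
def comp {G' : Type*} [LieRing G'] [LieAlgebra E G'] (P : LieFactor E G J) (φ : G' ≃ₗ⁅E⁆ G) :
    LieFactor E G' J where
  proj := P.proj.comp φ.toLieHom
  incl := φ.symm.toLinearEquiv.toLinearMap ∘ₗ P.incl
  proj_incl j := by
    change P.proj (φ (φ.symm (P.incl j))) = j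
    rw [LieEquiv.apply_symm_apply, P.proj_incl]
  incl_lie x j := by
    change φ.symm (P.incl ⁅P.proj (φ x), j⁆) = ⁅x, φ.symm (P.incl j)⁆
    rw [P.incl_lie, LieEquiv.map_lie, LieEquiv.symm_apply_apply]

theorem incl_map_lie (P : LieFactor E G J) (i j : J) : P.incl ⁅i, j⁆ = ⁅P.incl i, P.incl j⁆ := by
  rw [← P.incl_lie, P.proj_incl]

/-- The endomorphism of the factor `I` obtained by going to the factor `J` and back. -/
def roundTrip (Q : LieFactor E G I) (P : LieFactor E G J) : Module.End E I :=
  Q.proj.toLinearMap ∘ₗ P.incl ∘ₗ P.proj.toLinearMap ∘ₗ Q.incl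

theorem roundTrip_apply (Q : LieFactor E G I) (P : LieFactor E G J) (x : I) :
    Q.roundTrip P x = Q.proj (P.incl (P.proj (Q.incl x))) := rfl

/-- All four maps are equivariant for the action of `Q.incl y`, which acts on `J` through `P.proj`
and on `I` as `y`. This is what makes Fitting's lemma applicable. -/
theorem roundTrip_lie (Q : LieFactor E G I) (P : LieFactor E G J) (y x : I) :
    Q.roundTrip P ⁅y, x⁆ = ⁅y, Q.roundTrip P x⁆ := by
  rw [roundTrip_apply, incl_map_lie, LieHom.map_lie, P.incl_lie, LieHom.map_lie, Q.proj_incl,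
    roundTrip_apply]

/-- The part of the factor `J` that projects to zero in the factor `I`. -/
def kerIdeal (Q : LieFactor E G I) (P : LieFactor E G J) : LieIdeal E J :=
  { LinearMap.ker (Q.proj.toLinearMap ∘ₗ P.incl) with
    lie_mem := by
      intro x m hm
      change Q.proj (P.incl ⁅x, m⁆) = 0
      rw [incl_map_lie, LieHom.map_lie, show Q.proj (P.incl m) = 0 from hm, lie_zero] }

theorem mem_kerIdeal (Q : LieFactor E G I) (P : LieFactor E G J) (j : J) :
    j ∈ Q.kerIdeal P ↔ Q.proj (P.incl j) = 0 := Iff.rfl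

/-- If going from `I` to `J` and back is bijective, then `I` is a direct factor of `J`. -/
theorem nonempty_equiv_prod_kerIdeal (Q : LieFactor E G I) (P : LieFactor E G J)
    (h : IsUnit (Q.roundTrip P)) : Nonempty (J ≃ₗ⁅E⁆ (I × Q.kerIdeal P)) := by
  have hb : Function.Bijective (Q.roundTrip P) := (Module.End.isUnit_iff _).1 h
  -- The image of `I` in `J` is an ideal on which `j` acts only through its component in `I`; hence
  -- `Q.kerIdeal P` commutes with it.
  have hlie : ∀ (j : J) (x : I), ⁅j, P.proj (Q.incl x)⁆ =
      P.proj (Q.incl ⁅Q.proj (P.incl j), x⁆) := by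
    intro j x
    rw [Q.incl_lie, LieHom.map_lie, P.proj_incl]
  let f : (I × Q.kerIdeal P) →ₗ⁅E⁆ J :=
    { LinearMap.coprod (P.proj.toLinearMap ∘ₗ Q.incl) (Q.kerIdeal P).toSubmodule.subtype with
      map_lie' := by
        rintro ⟨x, k⟩ ⟨x', k'⟩
        change P.proj (Q.incl ⁅x, x'⁆) + ⁅(k : J), (k' : J)⁆ =
          ⁅P.proj (Q.incl x) + (k : J), P.proj (Q.incl x') + (k' : J)⁆
        have h1 : ⁅(k : J), P.proj (Q.incl x')⁆ = 0 := by
          rw [hlie, (mem_kerIdeal _ _ _).1 k.2]; simp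
        have h2 : ⁅P.proj (Q.incl x), (k' : J)⁆ = 0 := by
          rw [← lie_skew, hlie, (mem_kerIdeal _ _ _).1 k'.2]; simp
        rw [add_lie, lie_add, lie_add, h1, h2, incl_map_lie, LieHom.map_lie]
        simp }
  have hf : ∀ x k, f (x, k) = P.proj (Q.incl x) + (k : J) := fun _ _ => rfl
  have hfb : Function.Bijective f := by
    constructor
    · rw [← LieHom.coe_toLinearMap, ← LinearMap.ker_eq_bot, LinearMap.ker_eq_bot']
      rintro ⟨x, k⟩ hxk
      have hxk' : P.proj (Q.incl x) + (k : J) = 0 := hxk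
      have hx : Q.roundTrip P x = 0 := by
        rw [roundTrip_apply, eq_neg_of_add_eq_zero_left hxk', map_neg, map_neg,
          (mem_kerIdeal _ _ _).1 k.2, neg_zero]
      have hx0 : x = 0 := hb.1 (by rw [hx, map_zero])
      subst hx0
      have : (k : J) = 0 := by simpa using hxk'
      ext <;> simp [this]
    · intro j
      obtain ⟨x, hx⟩ := hb.2 (Q.proj (P.incl j))
      refine ⟨(x, ⟨j - P.proj (Q.incl x), ?_⟩), ?_⟩
      · rw [mem_kerIdeal, map_sub, map_sub, ← hx, roundTrip_apply, sub_self]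
      · rw [hf]; simp
  exact ⟨(LieEquiv.ofBijective f hfb).symm⟩

end LieFactor

/-- Exchange of an indecomposable factor. -/
theorem LieFactor.exchange {J' : Type*} [LieRing J'] [LieAlgebra E J'] (φ : (I × K) ≃ₗ⁅E⁆ (J × J'))
    (h : IsUnit ((LieFactor.fst (E := E) (J := I) (K := K)).roundTrip
      ((LieFactor.fst (E := E) (J := J) (K := J')).comp φ))) :
    ∃ J₁ : LieIdeal E J, Nonempty (J ≃ₗ⁅E⁆ (I × J₁)) ∧ Nonempty (K ≃ₗ⁅E⁆ (J₁ × J')) := by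
  refine ⟨_, LieFactor.nonempty_equiv_prod_kerIdeal _ _ h, ?_⟩
  set Q := LieFactor.fst (E := E) (J := I) (K := K)
  set P := (LieFactor.fst (E := E) (J := J) (K := J')).comp φ
  have hb : Function.Bijective (Q.roundTrip P) := (Module.End.isUnit_iff _).1 h
  have hQP : ∀ j, Q.proj (P.incl j) = (φ.symm (j, 0)).1 := fun _ => rfl
  have hPQ : ∀ x, P.proj (Q.incl x) = (φ (x, 0)).1 := fun _ => rfl
  -- The preimage of `kerIdeal × J'` under `φ` is a complement of `I` in `I × K`, so it projects
  -- isomorphically onto `K`.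
  let f : (Q.kerIdeal P × J') →ₗ⁅E⁆ K :=
    (LieHom.snd E I K).comp (φ.symm.toLieHom.comp
      (LieHom.prodMap (Q.kerIdeal P).incl LieHom.id))
  have hf : ∀ k j', f (k, j') = (φ.symm ((k : J), j')).2 := fun _ _ => rfl
  have hfb : Function.Bijective f := by
    constructor
    · rw [← LieHom.coe_toLinearMap, ← LinearMap.ker_eq_bot, LinearMap.ker_eq_bot']
      rintro ⟨k, j'⟩ hk
      have hk' : (φ.symm ((k : J), j')).2 = 0 := hk
      obtain ⟨x, hx⟩ : ∃ x : I, φ.symm ((k : J), j') = (x, 0) :=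
        ⟨_, Prod.ext rfl hk'⟩
      have hx' : φ (x, 0) = ((k : J), j') := by rw [← hx, LieEquiv.apply_symm_apply]
      have hx0 : x = 0 := hb.1 (by
        rw [map_zero, LieFactor.roundTrip_apply, hPQ, hx']
        exact k.2)
      subst hx0
      have h0 : ((k : J), j') = 0 := by
        rw [← hx', show ((0 : I), (0 : K)) = 0 from rfl]
        exact map_zero φ.toLinearEquiv
      have h1 := congrArg Prod.fst h0
      have h2 := congrArg Prod.snd h0
      exact Prod.ext (Subtype.ext h1) h2
    · intro y
      -- Subtracting this `x` from `(0, y)` leaves the component in `K` unchanged and moves the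
      -- component in `J` into the kernel ideal.
      obtain ⟨x, hx⟩ := hb.2 (Q.proj (P.incl (φ (0, y)).1))
      have hadd : φ (-x, y) = φ (0, y) - φ (x, 0) := by
        rw [← LieEquiv.coe_toLinearEquiv, ← map_sub]; simp
      refine ⟨(⟨(φ (-x, y)).1, ?_⟩, (φ (-x, y)).2), ?_⟩
      · rw [LieFactor.mem_kerIdeal, hadd, Prod.fst_sub, map_sub, map_sub, ← hx,
          LieFactor.roundTrip_apply, hPQ, sub_self]
      · rw [hf]
        simp
  exact ⟨(LieEquiv.ofBijective f hfb).symm⟩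

end Exchange

/-! ### Krull-Schmidt: cancellation and extraction of roots. -/

section KrullSchmidt

variable {E : Type*} [Field E]

/-- Products of isomorphisms of Lie algebras. -/
def LieEquiv.prodCongr {A B C D : Type*} [LieRing A] [LieAlgebra E A] [LieRing B] [LieAlgebra E B]
    [LieRing C] [LieAlgebra E C] [LieRing D] [LieAlgebra E D] (f : A ≃ₗ⁅E⁆ B) (g : C ≃ₗ⁅E⁆ D) :
    (A × C) ≃ₗ⁅E⁆ (B × D) where
  __ := f.toLinearEquiv.prodCongr g.toLinearEquiv
  map_lie' {x y} := Prod.ext (f.map_lie x.1 y.1) (g.map_lie x.2 y.2)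

/-- Associativity of products of Lie algebras. -/
def LieEquiv.prodAssoc (E A B C : Type*) [Field E] [LieRing A] [LieAlgebra E A] [LieRing B]
    [LieAlgebra E B] [LieRing C] [LieAlgebra E C] :
    ((A × B) × C) ≃ₗ⁅E⁆ (A × (B × C)) where
  __ := LinearEquiv.prodAssoc E A B C
  map_lie' {_ _} := rfl

/-- A trivial factor may be dropped. -/
def LieEquiv.uniqueProd (E A B : Type*) [Field E] [LieRing A] [LieAlgebra E A] [LieRing B]
    [LieAlgebra E B] [Subsingleton A] : (A × B) ≃ₗ⁅E⁆ B where
  __ := LieHom.snd E A B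
  invFun b := (0, b)
  left_inv _ := Prod.ext (Subsingleton.elim _ _) rfl
  right_inv _ := rfl

/-- Powers of isomorphic Lie algebras are isomorphic. -/
def LieEquiv.piCongr (ι : Type*) {A B : Type*} [LieRing A] [LieAlgebra E A] [LieRing B]
    [LieAlgebra E B] (f : A ≃ₗ⁅E⁆ B) : (ι → A) ≃ₗ⁅E⁆ (ι → B) where
  __ := LinearEquiv.piCongrRight fun _ : ι => f.toLinearEquiv
  map_lie' {x y} := funext fun i => f.map_lie (x i) (y i)

/-- A power of a product is the product of the powers. -/
def LieEquiv.piProd (E ι A B : Type*) [Field E] [LieRing A] [LieAlgebra E A] [LieRing B]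
    [LieAlgebra E B] : (ι → A × B) ≃ₗ⁅E⁆ ((ι → A) × (ι → B)) where
  toFun f := (fun i => (f i).1, fun i => (f i).2)
  map_add' _ _ := rfl
  map_smul' _ _ := rfl
  map_lie' {_ _} := rfl
  invFun p i := (p.1 i, p.2 i)
  left_inv _ := rfl
  right_inv _ := rfl

/-- One of the factors of a power is split off. -/
def LieEquiv.piSplit (E : Type*) {ι : Type*} [DecidableEq ι] (A : Type*) [Field E] [LieRing A]
    [LieAlgebra E A] (i₀ : ι) : (ι → A) ≃ₗ⁅E⁆ (A × ({i // i ≠ i₀} → A)) where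
  toFun x := (x i₀, fun i => x i)
  map_add' _ _ := rfl
  map_smul' _ _ := rfl
  map_lie' {_ _} := rfl
  invFun p i := if hi : i = i₀ then p.1 else p.2 ⟨i, hi⟩
  left_inv x := by
    funext i
    by_cases hi : i = i₀ <;> simp [hi]
  right_inv p := by
    refine Prod.ext (by simp) (funext fun i => ?_)
    simp [i.2]

/-- Any two trivial Lie algebras are isomorphic. -/
def LieEquiv.ofSubsingleton (E A B : Type*) [Field E] [LieRing A] [LieAlgebra E A] [LieRing B]
    [LieAlgebra E B] [Subsingleton A] [Subsingleton B] : A ≃ₗ⁅E⁆ B where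
  __ := (0 : A →ₗ⁅E⁆ B)
  invFun := 0
  left_inv _ := Subsingleton.elim _ _
  right_inv _ := Subsingleton.elim _ _

/-- A Lie algebra is the product of two complementary ideals. -/
theorem LieIdeal.nonempty_equiv_prod {X : Type*} [LieRing X] [LieAlgebra E X] {I J : LieIdeal E X}
    (h : IsCompl I J) : Nonempty (X ≃ₗ⁅E⁆ (I × J)) := by
  have h' := (LieSubmodule.isCompl_toSubmodule).2 h
  have hz : ∀ (x : I) (y : J), ⁅(x : X), (y : X)⁆ = 0 := by
    intro x y
    have hm : ⁅(x : X), (y : X)⁆ ∈ I ⊓ J :=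
      (LieSubmodule.mem_inf _ _ _).2 ⟨lie_mem_left E X I _ _ x.2, lie_mem_right E X J _ _ y.2⟩
    rwa [h.inf_eq_bot, LieSubmodule.mem_bot] at hm
  let e := Submodule.prodEquivOfIsCompl _ _ h'
  have he : ∀ p : I × J, e p = (p.1 : X) + (p.2 : X) := fun p =>
    Submodule.coe_prodEquivOfIsCompl' _ _ h' p
  let f : (I × J) ≃ₗ⁅E⁆ X :=
    { e with
      map_lie' := by
        intro p q
        change e ⁅p, q⁆ = ⁅e p, e q⁆
        rw [he, he, he, add_lie, lie_add, lie_add, hz p.1 q.2, ← lie_skew (p.2 : X) (q.1 : X),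
          hz q.1 p.2]
        simp }
  exact ⟨f.symm⟩

/-- A nonzero Lie algebra has a nonzero indecomposable factor. -/
theorem exists_indecomposable_factor.{u, v} {E : Type u} [Field E] : ∀ (n : ℕ) (X : Type v) [LieRing X] [LieAlgebra E X]
    [FiniteDimensional E X] [Nontrivial X], Module.finrank E X = n →
    ∃ (I X' : Type v) (_ : LieRing I) (_ : LieAlgebra E I) (_ : LieRing X')
      (_ : LieAlgebra E X') (_ : FiniteDimensional E I) (_ : FiniteDimensional E X')
      (_ : Nontrivial I), LieIsIndecomposable E I ∧ Nonempty (X ≃ₗ⁅E⁆ (I × X')) := by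
  intro n
  induction n using Nat.strong_induction_on with
  | _ n ih =>
  intro X _ _ _ _ hn
  by_cases hX : LieIsIndecomposable E X
  · obtain ⟨e⟩ := LieIdeal.nonempty_equiv_prod (E := E) (X := X) (isCompl_bot_top)
    -- The ideal `⊥` serves as a zero complement in the same universe.
    refine ⟨X, (⊥ : LieIdeal E X), _, _, _, _, inferInstance, inferInstance, inferInstance, hX, ?_⟩
    let f : ((⊥ : LieIdeal E X) × X) ≃ₗ⁅E⁆ (X × (⊥ : LieIdeal E X)) :=
      { LinearEquiv.prodComm E (⊥ : LieIdeal E X) X with map_lie' := rfl }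
    exact ⟨(LieEquiv.uniqueProd E (⊥ : LieIdeal E X) X).symm.trans f⟩
  · obtain ⟨A, B, hA, hB, hAB⟩ := not_not.1 hX
    obtain ⟨e⟩ := LieIdeal.nonempty_equiv_prod hAB
    have hlt : Module.finrank E A < n := by
      rw [← hn]
      refine Submodule.finrank_lt (s := A.toSubmodule) fun h => hA ?_
      rwa [← LieSubmodule.toSubmodule_eq_top]
    have : Nontrivial A := by
      by_contra hc
      rw [not_nontrivial_iff_subsingleton] at hc
      have : A = ⊥ := by
        rw [eq_bot_iff]
        exact fun x hx => (LieSubmodule.mem_bot _).2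
          (congrArg Subtype.val (Subsingleton.elim (⟨x, hx⟩ : A) 0))
      subst this
      exact hB (by simpa using hAB.sup_eq_top)
    obtain ⟨I, A', _, _, _, _, _, _, _, hI, ⟨e'⟩⟩ := ih _ hlt A rfl
    exact ⟨I, A' × B, _, _, _, _, inferInstance, inferInstance, inferInstance, hI,
      ⟨e.trans ((LieEquiv.prodCongr e' LieEquiv.refl).trans (LieEquiv.prodAssoc E I A' B))⟩⟩

/-- An indecomposable factor of a finite product is a factor of one of its members. -/
theorem LieIsIndecomposable.exists_factor {I K : Type*} [LieRing I] [LieAlgebra E I]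
    [FiniteDimensional E I] [Nontrivial I] [LieRing K] [LieAlgebra E K]
    (hI : LieIsIndecomposable E I) {ι : Type*} [Finite ι] (X : ι → Type*) [∀ i, LieRing (X i)]
    [∀ i, LieAlgebra E (X i)] (φ : (I × K) ≃ₗ⁅E⁆ (∀ i, X i)) :
    ∃ i, ∃ J : LieIdeal E (X i), Nonempty (X i ≃ₗ⁅E⁆ (I × J)) := by
  classical
  cases nonempty_fintype ι
  let Q := LieFactor.fst (E := E) (J := I) (K := K)
  -- The round trips through the members of the product sum to the identity of `I`.
  obtain ⟨i, -, hi⟩ := hI.exists_isUnit_of_isUnit_sum Finset.univ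
    (fun i => Q.roundTrip ((LieFactor.pi X i).comp φ)) (fun i => LieFactor.roundTrip_lie _ _) (by
      convert isUnit_one
      ext x
      rw [LinearMap.sum_apply]
      change ∑ i, (φ.symm.toLinearEquiv (Pi.single i (φ (x, 0) i))).1 = x
      rw [← Prod.fst_sum, ← map_sum, Finset.univ_sum_single]
      change (φ.symm (φ (x, 0))).1 = x
      rw [LieEquiv.symm_apply_apply])
  exact ⟨i, _, LieFactor.nonempty_equiv_prod_kerIdeal _ _ hi⟩

/-- The round trips of `I` through `J` and through `J'` sum to the identity, so one is invertible
and `I` can be exchanged into that factor. -/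
theorem LieIsIndecomposable.exchange {I K J J' : Type*} [LieRing I] [LieAlgebra E I]
    [FiniteDimensional E I] [Nontrivial I] [LieRing K] [LieAlgebra E K] [LieRing J]
    [LieAlgebra E J] [LieRing J'] [LieAlgebra E J']
    (hI : LieIsIndecomposable E I) (φ : (I × K) ≃ₗ⁅E⁆ (J × J')) :
    (∃ J₁ : LieIdeal E J, Nonempty (J ≃ₗ⁅E⁆ (I × J₁)) ∧ Nonempty (K ≃ₗ⁅E⁆ (J₁ × J'))) ∨
    (∃ J₁ : LieIdeal E J', Nonempty (J' ≃ₗ⁅E⁆ (I × J₁)) ∧ Nonempty (K ≃ₗ⁅E⁆ (J₁ × J))) := by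
  let Q := LieFactor.fst (E := E) (J := I) (K := K)
  let ψ : (J × J') ≃ₗ⁅E⁆ (J' × J) := { LinearEquiv.prodComm E J J' with map_lie' := rfl }
  let f : Bool → Module.End E I := fun b => cond b
    (Q.roundTrip ((LieFactor.fst (E := E) (J := J) (K := J')).comp φ))
    (Q.roundTrip ((LieFactor.fst (E := E) (J := J') (K := J)).comp (φ.trans ψ)))
  obtain ⟨b, -, hb⟩ := hI.exists_isUnit_of_isUnit_sum Finset.univ f (by
      rintro (_ | _)
      · exact LieFactor.roundTrip_lie _ _
      · exact LieFactor.roundTrip_lie _ _) (by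
      convert isUnit_one
      ext x
      rw [Fintype.sum_bool]
      change (φ.symm.toLinearEquiv ((φ (x, 0)).1, 0)).1 +
        (φ.symm.toLinearEquiv (0, (φ (x, 0)).2)).1 = x
      rw [← Prod.fst_add, ← map_add, Prod.mk_add_mk, add_zero, zero_add]
      change (φ.symm (φ (x, 0))).1 = x
      rw [LieEquiv.symm_apply_apply])
  cases b with
  | true => exact Or.inl (LieFactor.exchange φ hb)
  | false => exact Or.inr (LieFactor.exchange (φ.trans ψ) hb)

/-- Exchange `I` into the right-hand side. If it lands in `I`, the leftover `J₁` is zero by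
dimension; if it lands in `K'`, both `K` and `K'` are `I × J₁`. -/
theorem LieIsIndecomposable.cancel {I K K' : Type*} [LieRing I] [LieAlgebra E I]
    [FiniteDimensional E I] [Nontrivial I] [LieRing K] [LieAlgebra E K] [LieRing K']
    [LieAlgebra E K'] (hI : LieIsIndecomposable E I) (φ : (I × K) ≃ₗ⁅E⁆ (I × K')) :
    Nonempty (K ≃ₗ⁅E⁆ K') := by
  rcases hI.exchange φ with ⟨J₁, ⟨e⟩, ⟨e'⟩⟩ | ⟨J₁, ⟨e⟩, ⟨e'⟩⟩
  · have h := e.toLinearEquiv.finrank_eq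
    rw [Module.finrank_prod] at h
    have : Subsingleton J₁ := Module.finrank_zero_iff (R := E).1 (by omega)
    exact ⟨e'.trans (LieEquiv.uniqueProd E J₁ K')⟩
  · let f : (J₁ × I) ≃ₗ⁅E⁆ (I × J₁) := { LinearEquiv.prodComm E J₁ I with map_lie' := rfl }
    exact ⟨(e'.trans f).trans e.symm⟩

/-- Finite-dimensional Lie algebras may be cancelled from products. -/
theorem LieEquiv.nonempty_of_prod_left {K K' : Type*} [LieRing K] [LieAlgebra E K] [LieRing K']
    [LieAlgebra E K'] : ∀ (n : ℕ) (A : Type*) [LieRing A] [LieAlgebra E A] [FiniteDimensional E A],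
    Module.finrank E A = n → ((A × K) ≃ₗ⁅E⁆ (A × K')) → Nonempty (K ≃ₗ⁅E⁆ K') := by
  intro n
  induction n using Nat.strong_induction_on with
  | _ n ih =>
  intro A _ _ _ hn φ
  rcases subsingleton_or_nontrivial A with hA | hA
  · exact ⟨(LieEquiv.uniqueProd E A K).symm.trans (φ.trans (LieEquiv.uniqueProd E A K'))⟩
  · obtain ⟨I, A', _, _, _, _, _, _, _, hI, ⟨e⟩⟩ := exists_indecomposable_factor (E := E) _ A rfl
    have hd := e.toLinearEquiv.finrank_eq
    rw [Module.finrank_prod] at hd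
    have hpos := Module.finrank_pos (R := E) (M := I)
    let c : (A × K) ≃ₗ⁅E⁆ (I × (A' × K)) :=
      (LieEquiv.prodCongr e LieEquiv.refl).trans (LieEquiv.prodAssoc E I A' K)
    let c' : (A × K') ≃ₗ⁅E⁆ (I × (A' × K')) :=
      (LieEquiv.prodCongr e LieEquiv.refl).trans (LieEquiv.prodAssoc E I A' K')
    obtain ⟨e'⟩ := hI.cancel (c.symm.trans (φ.trans c'))
    exact ih _ (by omega) A' rfl e'

/-- Finite-dimensional Lie algebras with isomorphic finite powers are isomorphic. -/
theorem LieEquiv.nonempty_of_pi {ι : Type*} [Finite ι] [Nonempty ι] :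
    ∀ (n : ℕ) (g h : Type*) [LieRing g] [LieAlgebra E g] [FiniteDimensional E g] [LieRing h]
    [LieAlgebra E h] [FiniteDimensional E h], Module.finrank E g = n →
    ((ι → g) ≃ₗ⁅E⁆ (ι → h)) → Nonempty (g ≃ₗ⁅E⁆ h) := by
  classical
  cases nonempty_fintype ι
  intro n
  induction n using Nat.strong_induction_on with
  | _ n ih =>
  intro g h _ _ _ _ _ _ hn φ
  have hgh : Module.finrank E g = Module.finrank E h := by
    have := φ.toLinearEquiv.finrank_eq
    rw [Module.finrank_pi_fintype, Module.finrank_pi_fintype] at this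
    simpa using this
  rcases subsingleton_or_nontrivial g with hg | hg
  · have : Subsingleton h := Module.finrank_zero_iff (R := E).1 (by
      rw [← hgh]; exact Module.finrank_zero_of_subsingleton)
    exact ⟨LieEquiv.ofSubsingleton E g h⟩
  · obtain ⟨I, g', _, _, _, _, _, _, _, hI, ⟨e⟩⟩ := exists_indecomposable_factor (E := E) _ g rfl
    have hpos := Module.finrank_pos (R := E) (M := I)
    have hd := e.toLinearEquiv.finrank_eq
    rw [Module.finrank_prod] at hd
    have i₀ : ι := Classical.arbitrary ι
    let t := ((LieEquiv.piSplit E g i₀).trans (LieEquiv.prodCongr e LieEquiv.refl)).trans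
      (LieEquiv.prodAssoc E I g' ({i // i ≠ i₀} → g))
    -- `I` is a factor of a power of `h`, hence of `h`. Cancelling the power of `I` leaves powers of
    -- the smaller `g'` and `h'`.
    obtain ⟨-, h', ⟨e'⟩⟩ := hI.exists_factor (fun _ : ι => h) (t.symm.trans φ)
    obtain ⟨ψ⟩ := LieEquiv.nonempty_of_prod_left (E := E) _ (ι → I) rfl
      (((LieEquiv.piCongr ι e).trans (LieEquiv.piProd E ι I g')).symm.trans
        (φ.trans ((LieEquiv.piCongr ι e').trans (LieEquiv.piProd E ι I h'))))
    obtain ⟨χ⟩ := ih _ (by omega) g' h' rfl ψ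
    exact ⟨e.trans ((LieEquiv.prodCongr LieEquiv.refl χ).trans e'.symm)⟩

end KrullSchmidt

/-! ### Scalar extension and Galois conjugates. -/

section BaseChange

variable {F E : Type*} [Field F] [Field E] [Algebra F E]

/-- The extension to `E ⊗[F] L` of an `F`-linear homomorphism from `L` to a Lie algebra over `E`. -/
noncomputable def LieHom.liftBaseChange {L X : Type*} [LieRing L] [LieAlgebra F L] [LieRing X]
    [LieAlgebra F X] [LieAlgebra E X] [IsScalarTower F E X] (l : L →ₗ⁅F⁆ X) :
    (E ⊗[F] L) →ₗ⁅E⁆ X where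
  __ := LinearMap.liftBaseChange E l.toLinearMap
  map_lie' {x y} := by
    change LinearMap.liftBaseChange E l.toLinearMap ⁅x, y⁆ =
      ⁅LinearMap.liftBaseChange E l.toLinearMap x, LinearMap.liftBaseChange E l.toLinearMap y⁆
    induction x using TensorProduct.induction_on with
    | zero => simp
    | add x₁ x₂ h₁ h₂ => rw [add_lie, map_add, map_add, add_lie, h₁, h₂]
    | tmul a u =>
      induction y using TensorProduct.induction_on with
      | zero => simp
      | add y₁ y₂ h₁ h₂ => rw [lie_add, map_add, map_add, lie_add, h₁, h₂]
      | tmul b v =>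
        rw [LieAlgebra.ExtendScalars.bracket_tmul]
        simp only [LinearMap.liftBaseChange_tmul, LieHom.coe_toLinearMap, LieHom.map_lie, smul_lie,
          lie_smul, smul_smul, mul_comm b a]

theorem LieHom.liftBaseChange_tmul {L X : Type*} [LieRing L] [LieAlgebra F L] [LieRing X]
    [LieAlgebra F X] [LieAlgebra E X] [IsScalarTower F E X] (l : L →ₗ⁅F⁆ X) (a : E) (x : L) :
    LieHom.liftBaseChange (E := E) l (a ⊗ₜ x) = a • l x :=
  LinearMap.liftBaseChange_tmul E l.toLinearMap a x

/-- Isomorphic Lie algebras have isomorphic extensions of scalars. -/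
theorem LieEquiv.nonempty_baseChange (E : Type*) [Field E] [Algebra F E] {L L' : Type*} [LieRing L]
    [LieAlgebra F L] [LieRing L'] [LieAlgebra F L'] (φ : L ≃ₗ⁅F⁆ L') :
    Nonempty ((E ⊗[F] L) ≃ₗ⁅E⁆ (E ⊗[F] L')) := by
  let i : L' →ₗ⁅F⁆ E ⊗[F] L' :=
    { TensorProduct.mk F E L' 1 with
      map_lie' := by
        intro x y
        change (1 : E) ⊗ₜ[F] ⁅x, y⁆ = ⁅(1 : E) ⊗ₜ[F] x, (1 : E) ⊗ₜ[F] y⁆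
        rw [LieAlgebra.ExtendScalars.bracket_tmul, mul_one] }
  let f : (E ⊗[F] L) →ₗ⁅E⁆ (E ⊗[F] L') := LieHom.liftBaseChange (i.comp φ.toLieHom)
  have hf : ∀ z, f z = φ.toLinearEquiv.baseChange F E L L' z := by
    intro z
    induction z using TensorProduct.induction_on with
    | zero => simp
    | add x y hx hy => rw [map_add, map_add, hx, hy]
    | tmul a x =>
      rw [LieHom.liftBaseChange_tmul]
      change a • ((1 : E) ⊗ₜ[F] φ x) = a ⊗ₜ[F] φ x
      rw [TensorProduct.smul_tmul', smul_eq_mul, mul_one]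
  refine ⟨LieEquiv.ofBijective f ?_⟩
  rw [show (f : E ⊗[F] L → E ⊗[F] L') = φ.toLinearEquiv.baseChange F E L L' from funext hf]
  exact LinearEquiv.bijective _

/-- The vectors of conjugates of the elements of `E` span the space of functions on the Galois
group. -/
theorem span_conjugates_eq_top [FiniteDimensional F E] :
    Submodule.span E (Set.range fun (d : E) (σ : E ≃ₐ[F] E) => σ d) = ⊤ := by
  classical
  by_contra hne
  -- A functional vanishing on all conjugate vectors is a linear relation among the automorphisms,
  -- excluded by Dedekind.
  obtain ⟨f, hf0, hf⟩ := Submodule.exists_le_ker_of_lt_top _ (lt_top_iff_ne_top.2 hne)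
  have hfsum : ∀ v, f v = ∑ σ, v σ * f (Pi.single σ 1) := by
    intro v
    conv_lhs => rw [pi_eq_sum_univ' v]
    rw [map_sum]
    simp only [map_smul, smul_eq_mul]
  have hli := (linearIndependent_toLinearMap F E E).comp (fun σ : E ≃ₐ[F] E => (σ : E →ₐ[F] E))
    (fun σ τ h => AlgEquiv.ext fun x => DFunLike.congr_fun h x)
  have hz := Fintype.linearIndependent_iff.1 hli (fun σ => f (Pi.single σ 1)) (by
    ext d
    have h0 : f (fun σ : E ≃ₐ[F] E => σ d) = 0 := hf (Submodule.subset_span ⟨d, rfl⟩)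
    rw [hfsum] at h0
    rw [LinearMap.sum_apply, LinearMap.zero_apply, ← h0]
    exact Finset.sum_congr rfl fun σ _ => mul_comm _ _)
  refine hf0 (LinearMap.ext fun v => ?_)
  rw [hfsum]
  simp [hz]

/-- Extending the scalars of a Lie algebra over `E`, seen as a Lie algebra over `F`, back to `E`
gives the product of its conjugates. -/
theorem LieEquiv.nonempty_baseChange_pi [FiniteDimensional F E] [IsGalois F E] {g : Type*}
    [LieRing g] [LieAlgebra F g] [LieAlgebra E g] [IsScalarTower F E g] [FiniteDimensional E g]
    (X : (E ≃ₐ[F] E) → Type*) [∀ σ, LieRing (X σ)] [∀ σ, LieAlgebra F (X σ)]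
    [∀ σ, LieAlgebra E (X σ)] [∀ σ, IsScalarTower F E (X σ)] (θ : ∀ σ, g ≃ₗ⁅F⁆ X σ)
    (hθ : ∀ σ (e : E) (x : g), θ σ (e • x) = σ e • θ σ x) :
    Nonempty ((E ⊗[F] g) ≃ₗ⁅E⁆ (∀ σ, X σ)) := by
  classical
  have : FiniteDimensional F g := Module.Finite.trans E g
  let l : g →ₗ⁅F⁆ (∀ σ, X σ) :=
    { LinearMap.pi fun σ => (θ σ).toLinearEquiv.toLinearMap with
      map_lie' := by
        intro x y
        exact funext fun σ => (θ σ).map_lie x y }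
  let f := LieHom.liftBaseChange (E := E) l
  have hf : ∀ (a : E) (x : g) (σ), f (a ⊗ₜ x) σ = a • θ σ x := by
    intro a x σ
    rw [LieHom.liftBaseChange_tmul]
    rfl
  -- The admissible `w` form an `E`-subspace, and `1 ⊗ₜ (d • x)` realizes the vector of conjugates
  -- of `d`. Since these span, each single coordinate is reached.
  have hspan : ∀ w ∈ Submodule.span E (Set.range fun (d : E) (σ : E ≃ₐ[F] E) => σ d), ∀ x : g,
      ∃ z, ∀ σ, f z σ = w σ • θ σ x := by
    intro w hw x
    induction hw using Submodule.span_induction with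
    | mem w hw =>
      obtain ⟨d, rfl⟩ := hw
      exact ⟨1 ⊗ₜ (d • x), fun σ => by rw [hf, hθ, one_smul]⟩
    | zero => exact ⟨0, fun σ => by rw [map_zero]; simp⟩
    | add u v _ _ hu hv =>
      obtain ⟨a, ha⟩ := hu
      obtain ⟨b, hb⟩ := hv
      exact ⟨a + b, fun σ => by rw [map_add, Pi.add_apply, ha, hb, Pi.add_apply, add_smul]⟩
    | smul c u _ hu =>
      obtain ⟨a, ha⟩ := hu
      exact ⟨c • a, fun σ => by
        rw [map_smul, Pi.smul_apply, ha, Pi.smul_apply, smul_smul, smul_eq_mul]⟩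
  have hsingle : ∀ σ (y : X σ), ∃ z, f z = Pi.single σ y := by
    intro σ y
    obtain ⟨z, hz⟩ := hspan (Pi.single σ 1) (by rw [span_conjugates_eq_top]; trivial)
      ((θ σ).symm y)
    refine ⟨z, funext fun τ => ?_⟩
    rw [hz]
    by_cases h : τ = σ
    · subst h; simp
    · simp [h]
  have hsurj : Function.Surjective f := by
    intro v
    choose z hz using fun σ => hsingle σ (v σ)
    refine ⟨∑ σ, z σ, ?_⟩
    rw [map_sum]
    simp only [hz]
    exact Finset.univ_sum_single v
  have hfin : FiniteDimensional E (∀ σ, X σ) :=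
    Module.Finite.of_surjective f.toLinearMap hsurj
  have hX : ∀ σ, FiniteDimensional E (X σ) := fun σ =>
    Module.Finite.of_surjective (LinearMap.proj σ : (∀ σ, X σ) →ₗ[E] X σ)
      (Function.surjective_eval σ)
  have hrank : ∀ σ, Module.finrank E (X σ) = Module.finrank E g := by
    intro σ
    have h1 := (θ σ).toLinearEquiv.finrank_eq
    rw [← Module.finrank_mul_finrank F E g, ← Module.finrank_mul_finrank F E (X σ)] at h1
    exact (Nat.eq_of_mul_eq_mul_left Module.finrank_pos h1).symm
  have hinj : Function.Injective f := by
    refine (LinearMap.injective_iff_surjective_of_finrank_eq_finrank (f := f.toLinearMap) ?_).2 hsurj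
    rw [Module.finrank_baseChange, Module.finrank_pi_fintype]
    simp only [hrank, Finset.sum_const, Finset.card_univ, smul_eq_mul]
    rw [← Nat.card_eq_fintype_card, IsGalois.card_aut_eq_finrank, Module.finrank_mul_finrank]
  exact ⟨LieEquiv.ofBijective f ⟨hinj, hsurj⟩⟩

/-! ### Conjugates and descent. -/

/-- The conjugate of a Lie algebra over `E` by an automorphism of `E`: the same Lie ring, on which
`E` acts through the inverse of the automorphism. -/
def GaloisConjugate (_σ : E ≃ₐ[F] E) (h : Type*) : Type _ := h

namespace GaloisConjugate

variable (σ : E ≃ₐ[F] E) (h : Type*) [LieRing h]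

instance : LieRing (GaloisConjugate σ h) := inferInstanceAs (LieRing h)

instance [LieAlgebra F h] : LieAlgebra F (GaloisConjugate σ h) := inferInstanceAs (LieAlgebra F h)

/-- The identity, seen as a map to the conjugate. -/
def of [LieAlgebra F h] : h ≃ₗ⁅F⁆ GaloisConjugate σ h := LieEquiv.refl

instance [LieAlgebra E h] : LieAlgebra E (GaloisConjugate σ h) where
  __ := Module.compHom h (σ.symm : E →+* E)
  lie_smul e x y := LieAlgebra.lie_smul (L := h) (σ.symm e) x y

theorem of_smul [LieAlgebra F h] [LieAlgebra E h] (e : E) (x : h) :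
    of σ h (e • x) = σ e • of σ h x := by
  change e • x = σ.symm (σ e) • x
  rw [AlgEquiv.symm_apply_apply]

instance [LieAlgebra F h] [LieAlgebra E h] [IsScalarTower F E h] :
    IsScalarTower F E (GaloisConjugate σ h) where
  smul_assoc a e x := by
    change (σ.symm (a • e) • (show h from x) : h) = a • (σ.symm e • (show h from x))
    rw [map_smul, smul_assoc]

end GaloisConjugate

/-- A Lie algebra defined over `F` has semilinear automorphisms. -/
theorem LieIsDefinedOver.exists_semilinear {g : Type*} [LieRing g] [LieAlgebra F g]
    [LieAlgebra E g] [IsScalarTower F E g] (hg : LieIsDefinedOver F E g) (σ : E ≃ₐ[F] E) :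
    ∃ ρ : g ≃ₗ⁅F⁆ g, ∀ (e : E) (x : g), ρ (e • x) = σ e • ρ x := by
  obtain ⟨L, _, _, ⟨ψ⟩⟩ := hg
  -- The automorphism wanted is `σ ⊗ id`, transported along `ψ`.
  let m (τ : E ≃ₐ[F] E) : (E ⊗[F] L) →ₗ⁅F⁆ (E ⊗[F] L) :=
    LieAlgebra.ExtendScalars.map (τ : E →ₐ[F] E) LieHom.id
  have hm : ∀ τ (a : E) (x : L), m τ (a ⊗ₜ x) = τ a ⊗ₜ x := fun _ _ _ => rfl
  have hinv : ∀ τ₁ τ₂ : E ≃ₐ[F] E, (∀ a, τ₁ (τ₂ a) = a) → ∀ z, m τ₁ (m τ₂ z) = z := by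
    intro τ₁ τ₂ h z
    induction z using TensorProduct.induction_on with
    | zero => simp
    | add x y hx hy => rw [map_add, map_add, hx, hy]
    | tmul a x => rw [hm, hm, h]
  have hsmul : ∀ τ (e : E) z, m τ (e • z) = τ e • m τ z := by
    intro τ e z
    induction z using TensorProduct.induction_on with
    | zero => simp
    | add x y hx hy => rw [smul_add, map_add, map_add, smul_add, hx, hy]
    | tmul a x =>
      rw [TensorProduct.smul_tmul', hm, hm, TensorProduct.smul_tmul', smul_eq_mul, smul_eq_mul,
        map_mul]
  have hψ : ∀ (e : E) x, ψ (e • x) = e • ψ x := fun e x => map_smul ψ.toLinearEquiv e x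
  have hψs : ∀ (e : E) x, ψ.symm (e • x) = e • ψ.symm x :=
    fun e x => map_smul ψ.symm.toLinearEquiv e x
  have hρ : ∀ (e : E) (x : g), ψ.symm (m σ (ψ (e • x))) = σ e • ψ.symm (m σ (ψ x)) := by
    intro e x
    rw [hψ, hsmul, hψs]
  let ρ : g ≃ₗ⁅F⁆ g :=
    { toFun := fun x => ψ.symm (m σ (ψ x))
      map_add' := fun x y => by
        rw [show ψ (x + y) = ψ x + ψ y from map_add ψ.toLinearEquiv x y, map_add]
        exact map_add ψ.symm.toLinearEquiv _ _
      map_smul' := fun a x => by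
        rw [← algebraMap_smul E a x, hρ, AlgEquiv.commutes, algebraMap_smul, RingHom.id_apply]
      map_lie' := by
        intro x y
        rw [LieEquiv.map_lie, LieHom.map_lie, LieEquiv.map_lie]
      invFun := fun x => ψ.symm (m σ.symm (ψ x))
      left_inv := fun x => by
        simp only [LieEquiv.apply_symm_apply]
        rw [hinv _ _ σ.symm_apply_apply, LieEquiv.symm_apply_apply]
      right_inv := fun x => by
        simp only [LieEquiv.apply_symm_apply]
        rw [hinv _ _ σ.apply_symm_apply, LieEquiv.symm_apply_apply] }
  exact ⟨ρ, hρ⟩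

/-- If a Lie algebra over `E` is defined over `F`, then its extension of scalars from `F` to `E` is
a power of it. -/
theorem LieIsDefinedOver.nonempty_baseChange_equiv [FiniteDimensional F E] [IsGalois F E]
    {g : Type*} [LieRing g] [LieAlgebra F g] [LieAlgebra E g] [IsScalarTower F E g]
    [FiniteDimensional E g] (hg : LieIsDefinedOver F E g) :
    Nonempty ((E ⊗[F] g) ≃ₗ⁅E⁆ ((E ≃ₐ[F] E) → g)) := by
  choose ρ hρ using hg.exists_semilinear
  exact LieEquiv.nonempty_baseChange_pi (fun _ => g) ρ hρ

theorem LieIsDefinedOver.nonempty_equiv_of_restrictScalars [FiniteDimensional F E] [IsGalois F E]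
    {g h : Type*} [LieRing g] [LieAlgebra F g] [LieAlgebra E g] [IsScalarTower F E g]
    [FiniteDimensional E g] [LieRing h] [LieAlgebra F h] [LieAlgebra E h] [IsScalarTower F E h]
    [FiniteDimensional E h] (hg : LieIsDefinedOver F E g) (φ : g ≃ₗ⁅F⁆ h)
    (hcase : LieIsDefinedOver F E h ∨ LieIsIndecomposable E g) : Nonempty (g ≃ₗ⁅E⁆ h) := by
  classical
  obtain ⟨α⟩ := hg.nonempty_baseChange_equiv
  obtain ⟨β⟩ := LieEquiv.nonempty_baseChange E φ
  rcases hcase with hh | hind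
  · obtain ⟨γ⟩ := hh.nonempty_baseChange_equiv
    exact LieEquiv.nonempty_of_pi (E := E) _ g h rfl (α.symm.trans (β.trans γ))
  -- The zero algebra counts as indecomposable here, but the factor argument needs `g` nonzero.
  rcases subsingleton_or_nontrivial g with hs | hs
  · have : Subsingleton h := φ.symm.injective.subsingleton
    exact ⟨LieEquiv.ofSubsingleton E g h⟩
  obtain ⟨γ⟩ := LieEquiv.nonempty_baseChange_pi (fun σ : E ≃ₐ[F] E => GaloisConjugate σ h)
    (fun σ => GaloisConjugate.of σ h) (fun σ => GaloisConjugate.of_smul σ h)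
  obtain ⟨σ, J, ⟨e⟩⟩ := hind.exists_factor _
    ((LieEquiv.piSplit E g (1 : E ≃ₐ[F] E)).symm.trans (α.symm.trans (β.trans γ)))
  have hfin : FiniteDimensional F g := Module.Finite.trans E g
  have hfin' : FiniteDimensional F (GaloisConjugate σ h) :=
    Module.Finite.equiv (φ.trans (GaloisConjugate.of σ h)).toLinearEquiv
  have hfinE : FiniteDimensional E (GaloisConjugate σ h) :=
    Module.Finite.of_restrictScalars_finite F E _
  -- `g` and the conjugate of `h` have equal dimension over `F`, hence over `E`, leaving no room for
  -- `J`.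
  have : Subsingleton J := by
    have h1 := (φ.trans (GaloisConjugate.of σ h)).toLinearEquiv.finrank_eq
    rw [← Module.finrank_mul_finrank F E g,
      ← Module.finrank_mul_finrank F E (GaloisConjugate σ h)] at h1
    have h2 := Nat.eq_of_mul_eq_mul_left Module.finrank_pos h1
    have h3 := e.toLinearEquiv.finrank_eq
    rw [Module.finrank_prod] at h3
    exact Module.finrank_zero_iff (R := E).1 (by omega)
  let e' : GaloisConjugate σ h ≃ₗ⁅E⁆ g :=
    { LinearEquiv.ofBijective ((LinearMap.fst E g J) ∘ₗ e.toLinearEquiv.toLinearMap)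
        (Function.Bijective.comp
          (g := LinearMap.fst E g J) ⟨fun x y hxy => Prod.ext hxy (Subsingleton.elim _ _),
            Prod.fst_surjective⟩ e.bijective) with
      map_lie' := by
        intro x y
        exact congrArg Prod.fst (e.map_lie x y) }
  -- The `σ⁻¹`-semilinear `ρ` offsets the `σ`-semilinear identity from `h` to its conjugate, so the
  -- composite is `E`-linear.
  obtain ⟨ρ, hρ⟩ := hg.exists_semilinear σ.symm
  let t : h ≃ₗ⁅E⁆ g :=
    { toFun := fun x => ρ (e' (GaloisConjugate.of σ h x))
      map_add' := fun x y => by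
        change ρ.toLinearEquiv (e'.toLinearEquiv ((GaloisConjugate.of σ h).toLinearEquiv (x + y))) =
          ρ.toLinearEquiv (e'.toLinearEquiv ((GaloisConjugate.of σ h).toLinearEquiv x)) +
          ρ.toLinearEquiv (e'.toLinearEquiv ((GaloisConjugate.of σ h).toLinearEquiv y))
        simp only [map_add]
      map_smul' := fun a x => by
        rw [GaloisConjugate.of_smul,
          show e' (σ a • GaloisConjugate.of σ h x) = σ a • e' (GaloisConjugate.of σ h x) from
            map_smul e'.toLinearEquiv _ _, hρ, AlgEquiv.symm_apply_apply, RingHom.id_apply]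
      map_lie' := by
        intro x y
        rw [LieEquiv.map_lie, LieEquiv.map_lie, LieEquiv.map_lie]
      invFun := fun y => (GaloisConjugate.of σ h).symm (e'.symm (ρ.symm y))
      left_inv := fun x => by simp
      right_inv := fun y => by simp }
  exact ⟨t.symm⟩

end BaseChange

theorem mainTheorem4 {F E g h : Type*} [Field F] [Field E] [Algebra F E]
    [FiniteDimensional F E] [IsGalois F E]
    [LieRing g] [LieAlgebra E g] [FiniteDimensional E g]
    [LieRing h] [LieAlgebra E h] [FiniteDimensional E h]
    (hg : LieIsDefinedOver F E g)
    (hgh : Nonempty (RestrictScalars F E g ≃ₗ⁅F⁆ RestrictScalars F E h))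
    (hcase : LieIsDefinedOver F E h ∨ LieIsIndecomposable E g) :
    Nonempty (g ≃ₗ⁅E⁆ h) := by
  obtain ⟨φ⟩ := hgh
  let _ : LieAlgebra F g := LieAlgebra.RestrictScalars.lieAlgebra F E g
  let _ : LieAlgebra F h := LieAlgebra.RestrictScalars.lieAlgebra F E h
  have hgt : IsScalarTower F E g := IsScalarTower.of_algebraMap_smul fun _ _ => rfl
  have hht : IsScalarTower F E h := IsScalarTower.of_algebraMap_smul fun _ _ => rfl
  have φ' : g ≃ₗ⁅F⁆ h := φ
  exact hg.nonempty_equiv_of_restrictScalars φ' hcase
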